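/- For a sequence ${\bf c} = (c_1, \dots, c_n)$ of integers with $n \geq 1$ and $1 \leq c_1 \leq \dots \leq c_n$, let $S_{\bf c} = [c_1] \times \dots \times [c_n]$, where $[k] = \{1, \dots, k\}$, and let $S_{\bf c}(1) = \{(a_1, \dots, a_n) \in S_{\bf c} \colon a_1 = 1\}$. Two sequences $(a_1, \dots, a_n), (b_1, \dots, b_n) \in S_{\bf c}$ meet if $a_i = b_i$ for some $i \in [n]$. If $A, B \subseteq S_{\bf c}$ are such that each sequence in $A$ meets each sequence in $B$, then \[|A||B| \leq \left(\frac{|S_{\bf c}|}{c_1}\right)^2 = \left(\frac{1}{c_1}\prod_{i=1}^n c_i\right)^2,\] and equality holds if $A = B = S_{\bf c}(1)$. Moreover, unless $c_1 = 2$, the bound is attained if and only if $A = B = \{(a_1, \dots, a_n) \in S_{\bf c} \colon a_p = q\}$ for some $p \in [n]$ with $c_p = c_1$ and some $q \in [c_p]$. -/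

import Mathlib

/-- `c` is an increasing positive (IP) sequence: `1 ≤ c_1 ≤ ... ≤ c_n`
(entries are indexed by `Fin n`, so `c 0` is the first entry `c_1`). -/
def IsIPSeq {n : ℕ} (c : Fin n → ℕ) : Prop :=
  Monotone c ∧ ∀ i, 1 ≤ c i

/-- `S_c = [c_1] × ... × [c_n]`: the positive integer sequences of length `n` whose
`i`-th entry is at most `c i`. -/
def seqSet {n : ℕ} (c : Fin n → ℕ) : Finset (Fin n → ℕ) :=
  Fintype.piFinset fun i => Finset.Icc 1 (c i)

/-- The members of `S_c` whose `p`-th entry is `q`. -/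
def seqStar {n : ℕ} (c : Fin n → ℕ) (p : Fin n) (q : ℕ) : Finset (Fin n → ℕ) :=
  (seqSet c).filter fun a => a p = q

/-- Two sequences meet if they agree on some positive entry. -/
def Meets {n : ℕ} (a b : Fin n → ℕ) : Prop :=
  ∃ i, a i = b i ∧ a i ≠ 0

/-- Each sequence in `A` meets each sequence in `B`. -/
def CrossIntersecting {n : ℕ} (A B : Finset (Fin n → ℕ)) : Prop :=
  ∀ a ∈ A, ∀ b ∈ B, Meets a b

/-!
The proof is the spectral ratio bound of Hoffman type. Join two points of a product `∏ α i` when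
they differ in every coordinate: cross-intersecting families are pairs `A`, `B` with no edge between
them. The normalized adjacency operator `T` of this graph is the product over the coordinates of
`E i - r i • (1 - E i)`, where `E i` averages over coordinate `i` and `r i = 1 / (|α i| - 1)`. The
`E i` are commuting orthogonal projections, so `T` is the identity on constants and contracts their
orthogonal complement by `R = 1 / (k - 1)`, where `k` is the least size of a factor
(`norm_dampedProd_sub_le`). Since the indicator of `A` is orthogonal to `T` applied to that of `B`,
Cauchy-Schwarz bounds the densities `a`, `b` of the families by
`(a b)² ≤ R² a (1 - a) b (1 - b)`, whence `a b ≤ 1 / k²`.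

If the bound is attained and `k ≥ 3`, then `R < 1`. The part of an indicator on which both `1 - E i`
and `1 - E j` act as the identity is contracted by `R²` (`norm_dampedProd_sub_le_of_pair`), so it
must vanish for all `i ≠ j`. The indicator is therefore a sum of functions of single coordinates,
and as it takes only the values `0` and `1` it depends on at most one
coordinate (`exists_forall_update_eq`). Two nonempty cross-intersecting families of this kind must
depend on the same coordinate and allow the same single value there (`eq_star_of_card_mul_card_eq`).
A comparison of sizes then shows that this coordinate has the least size.

For `c 0 = 1` the bound is `|A| |B| ≤ |S|²`, attained only by `A = B = S`, which is a star.
-/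

/-! ### Products of damped commuting projections -/

section DampedProjections

variable {V : Type*} [NormedAddCommGroup V] [InnerProductSpace ℝ V] {ι : Type*}

/-- The product, in the order of the list `l`, of the operators `E i - r i • (1 - E i)`. When `E i`
is a projection, the factor fixes its range and multiplies its kernel by `-r i`. -/
def dampedProd (E : ι → Module.End ℝ V) (r : ι → ℝ) (l : List ι) : Module.End ℝ V :=
  (l.map fun i => E i - r i • (1 - E i)).prod

theorem commute_damped {E : ι → Module.End ℝ V} (hcomm : ∀ i j, Commute (E i) (E j))
    (r : ι → ℝ) (i j : ι) : Commute (E i) (E j - r j • (1 - E j)) :=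
  (hcomm i j).sub_right (((Commute.one_right _).sub_right (hcomm i j)).smul_right _)

theorem commute_dampedProd {E : ι → Module.End ℝ V} (hcomm : ∀ i j, Commute (E i) (E j))
    (r : ι → ℝ) (i : ι) (l : List ι) : Commute (E i) (dampedProd E r l) := by
  refine Commute.list_prod_right _ _ fun x hx => ?_
  obtain ⟨j, -, rfl⟩ := List.mem_map.1 hx
  exact commute_damped hcomm r i j

theorem commute_projProd {E : ι → Module.End ℝ V} (hcomm : ∀ i j, Commute (E i) (E j))
    (i : ι) (l : List ι) : Commute (E i) (l.map E).prod := by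
  refine Commute.list_prod_right _ _ fun x hx => ?_
  obtain ⟨j, -, rfl⟩ := List.mem_map.1 hx
  exact hcomm i j

theorem inner_proj_sub_eq_zero {Q : Module.End ℝ V} (hs : Q.IsSymmetric) (hi : Q * Q = Q)
    (u v : V) : inner ℝ (Q u) (v - Q v) = 0 := by
  rw [hs, map_sub, ← Module.End.mul_apply, hi, sub_self, inner_zero_right]

theorem norm_sq_add_of_inner_eq_zero {u v : V} (h : inner ℝ u v = 0) :
    ‖u + v‖ ^ 2 = ‖u‖ ^ 2 + ‖v‖ ^ 2 := by
  rw [norm_add_sq_real, h]; ring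

theorem norm_sq_proj_add {Q : Module.End ℝ V} (hs : Q.IsSymmetric) (hi : Q * Q = Q)
    (v : V) : ‖v‖ ^ 2 = ‖Q v‖ ^ 2 + ‖v - Q v‖ ^ 2 := by
  rw [← norm_sq_add_of_inner_eq_zero (inner_proj_sub_eq_zero hs hi v v), add_sub_cancel]

theorem dampedProd_cons_apply (E : ι → Module.End ℝ V) (r : ι → ℝ) (i : ι) (l : List ι) (g : V) :
    dampedProd E r (i :: l) g = E i (dampedProd E r l g)
      + (-r i) • (dampedProd E r l g - E i (dampedProd E r l g)) := by
  simp only [dampedProd, List.map_cons, List.prod_cons, Module.End.mul_apply, LinearMap.sub_apply,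
    LinearMap.smul_apply, Module.End.one_apply]
  module

theorem norm_dampedProd_le {E : ι → Module.End ℝ V} (hsymm : ∀ i, (E i).IsSymmetric)
    (hidem : ∀ i, E i * E i = E i) {r : ι → ℝ} (hr0 : ∀ i, 0 ≤ r i) (hr1 : ∀ i, r i ≤ 1)
    (l : List ι) (g : V) : ‖dampedProd E r l g‖ ^ 2 ≤ ‖g‖ ^ 2 := by
  induction l with
  | nil => simp [dampedProd]
  | cons i l ih =>
    set h := dampedProd E r l g with hh
    have h1 : dampedProd E r (i :: l) g = E i h + (-r i) • (h - E i h) :=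
      dampedProd_cons_apply E r i l g
    have h2 : inner ℝ (E i h) ((-r i) • (h - E i h)) = 0 := by
      rw [inner_smul_right, inner_proj_sub_eq_zero (hsymm i) (hidem i), mul_zero]
    refine le_trans ?_ ih
    rw [h1, norm_sq_add_of_inner_eq_zero h2, norm_smul, norm_neg, mul_pow,
      norm_sq_proj_add (hsymm i) (hidem i) h, Real.norm_eq_abs, sq_abs]
    have : r i ^ 2 ≤ 1 := pow_le_one₀ (hr0 i) (hr1 i)
    nlinarith [sq_nonneg ‖h - E i h‖]

/-- Away from the common range of the projections, the damped product contracts by the largest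
damping factor. Each projection splits the vector orthogonally: the range part is handled by the
remaining factors, the kernel part is already damped once. -/
theorem norm_dampedProd_sub_le {E : ι → Module.End ℝ V} (hsymm : ∀ i, (E i).IsSymmetric)
    (hidem : ∀ i, E i * E i = E i) (hcomm : ∀ i j, Commute (E i) (E j)) {r : ι → ℝ} {R : ℝ}
    (hr0 : ∀ i, 0 ≤ r i) (hrR : ∀ i, r i ≤ R) (hR : R ≤ 1) (l : List ι) (g : V) :
    ‖dampedProd E r l g - (l.map E).prod g‖ ^ 2 ≤ R ^ 2 * ‖g - (l.map E).prod g‖ ^ 2 := by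
  induction l generalizing g with
  | nil => simp [dampedProd]
  | cons i l ih =>
    set T := dampedProd E r l with hT
    set P := (l.map E).prod with hP
    have hET : ∀ v, E i (T v) = T (E i v) := fun v =>
      LinearMap.congr_fun (commute_dampedProd hcomm r i l) v
    have hEP : ∀ v, E i (P v) = P (E i v) := fun v =>
      LinearMap.congr_fun (commute_projProd hcomm i l) v
    have h1 : dampedProd E r (i :: l) g - ((i :: l).map E).prod g
        = E i (T g - P g) + (-r i) • (T g - E i (T g)) := by
      rw [dampedProd_cons_apply, ← hT, List.map_cons, List.prod_cons, Module.End.mul_apply, map_sub]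
      abel
    have h2 : g - ((i :: l).map E).prod g = E i (g - P g) + (g - E i g) := by
      simp [hP]
    have h3 : inner ℝ (E i (T g - P g)) ((-r i) • (T g - E i (T g))) = 0 := by
      rw [inner_smul_right, inner_proj_sub_eq_zero (hsymm i) (hidem i), mul_zero]
    rw [h1, h2, norm_sq_add_of_inner_eq_zero h3,
      norm_sq_add_of_inner_eq_zero (inner_proj_sub_eq_zero (hsymm i) (hidem i) _ _),
      norm_smul, norm_neg, mul_pow, Real.norm_eq_abs, sq_abs, map_sub, map_sub, hET, hEP,
      ← map_sub]
    have h4 := ih (E i g)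
    have h5 := norm_dampedProd_le hsymm hidem hr0 (fun i => (hrR i).trans hR) l (g - E i g)
    rw [← hT] at h5
    have h6 : r i ^ 2 ≤ R ^ 2 := pow_le_pow_left₀ (hr0 i) (hrR i) 2
    have h7 := mul_le_mul h6 h5 (sq_nonneg _) (sq_nonneg R)
    linarith

/-- The part of a vector killed by two of the projections is damped twice. This is the gain over
`norm_dampedProd_sub_le` that rules out this part in the extremal case. -/
theorem norm_dampedProd_sub_le_of_pair {E : ι → Module.End ℝ V}
    (hsymm : ∀ i, (E i).IsSymmetric)
    (hidem : ∀ i, E i * E i = E i) (hcomm : ∀ i j, Commute (E i) (E j)) {r : ι → ℝ} {R : ℝ}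
    (hr0 : ∀ i, 0 ≤ r i) (hrR : ∀ i, r i ≤ R) (hR : R ≤ 1) (i j : ι) (l : List ι) (g : V) :
    ‖dampedProd E r (i :: j :: l) g - ((i :: j :: l).map E).prod g‖ ^ 2 ≤
      R ^ 2 * ‖g - ((i :: j :: l).map E).prod g‖ ^ 2
        - (R ^ 2 - R ^ 4) * ‖((1 - E i) * (1 - E j)) g‖ ^ 2 := by
  set T := dampedProd E r (i :: j :: l) with hT
  set P := ((i :: j :: l).map E).prod with hP
  set Q : Module.End ℝ V := (1 - E i) * (1 - E j) with hQ
  have hDD : Commute (1 - E i) (1 - E j) :=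
    (Commute.one_left _).sub_left ((Commute.one_right _).sub_right (hcomm i j))
  have hDi : ∀ i, (1 - E i) * (1 - E i) = 1 - E i := fun i => by
    simp [mul_sub, sub_mul, hidem]
  have hQi : Q * Q = Q := by
    rw [hQ, ← mul_assoc, mul_assoc (1 - E i), ← hDD.eq, ← mul_assoc, hDi, mul_assoc, hDi]
  have hQs : Q.IsSymmetric := by
    have hD : ∀ i, (1 - E i).IsSymmetric := fun i => LinearMap.IsSymmetric.one.sub (hsymm i)
    intro u v
    rw [hQ, Module.End.mul_apply, hD i, hD j, ← Module.End.mul_apply, ← hDD.eq]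
  have hcQ : ∀ S : Module.End ℝ V, (∀ k, Commute (E k) S) → Commute Q S := fun S hS =>
    Commute.mul_left ((Commute.one_left _).sub_left (hS i))
      ((Commute.one_left _).sub_left (hS j))
  have hQT : Commute Q T := hcQ _ fun k => commute_dampedProd hcomm r k _
  have hQP : Commute Q P := hcQ _ fun k => commute_projProd hcomm k _
  have hDE : ∀ i, (1 - E i) * E i = 0 := fun i => by simp [sub_mul, hidem]
  have hQP0 : Q * P = 0 := by
    have : P = E i * (E j * (l.map E).prod) := by simp [hP]
    rw [hQ, hDD.eq, this, mul_assoc, ← mul_assoc (1 - E i), hDE, zero_mul, mul_zero]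
  have hDT : ∀ i, (1 - E i) * (E i - r i • (1 - E i)) = -r i • (1 - E i) := fun i => by
    rw [mul_sub, hDE, mul_smul_comm, hDi]; simp
  have hTQ : Q * T = (r i * r j) • (Q * dampedProd E r l) := by
    have h1 : T = (E i - r i • (1 - E i)) * ((E j - r j • (1 - E j)) * dampedProd E r l) := by
      simp [hT, dampedProd]
    have h2 : Commute (1 - E j) (E i - r i • (1 - E i)) :=
      (Commute.one_left _).sub_left (commute_damped hcomm r j i)
    rw [h1, hQ, mul_assoc, ← mul_assoc (1 - E j), h2.eq, mul_assoc _ (1 - E j),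
      ← mul_assoc (1 - E j), hDT, ← mul_assoc, hDT]
    simp [mul_assoc, smul_smul, mul_comm (r j)]
  have eQT : ∀ v, Q (T v) = T (Q v) := LinearMap.congr_fun hQT
  have eQP : ∀ v, Q (P v) = 0 := LinearMap.congr_fun hQP0
  have ePQ : ∀ v, P (Q v) = 0 := fun v => (LinearMap.congr_fun hQP v).symm.trans (eQP v)
  -- Split along the projection `Q`.
  have h1 := norm_sq_proj_add hQs hQi (T g - P g)
  have h2 := norm_sq_proj_add hQs hQi (g - P g)
  have h3 : Q (T g - P g) = (r i * r j) • dampedProd E r l (Q g) := by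
    have := LinearMap.congr_fun hTQ g
    have h4 := LinearMap.congr_fun (hcQ _ fun k => commute_dampedProd hcomm r k l) g
    simp only [Module.End.mul_apply, LinearMap.smul_apply] at this h4
    rw [map_sub, eQP, sub_zero, this, h4]
  have h5 : T g - P g - Q (T g - P g) = T (g - Q g) - P (g - Q g) := by
    rw [map_sub, map_sub, map_sub, ePQ, eQP, eQT]; abel
  have h6 : g - P g - Q (g - P g) = (g - Q g) - P (g - Q g) := by
    rw [map_sub, map_sub, ePQ, eQP]; abel
  have h7 : Q (g - P g) = Q g := by rw [map_sub, eQP, sub_zero]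
  rw [h6, h7] at h2
  rw [h5, h3, norm_smul, mul_pow, Real.norm_eq_abs, sq_abs] at h1
  have h8 := norm_dampedProd_sub_le hsymm hidem hcomm hr0 hrR hR (i :: j :: l) (g - Q g)
  have h9 := norm_dampedProd_le hsymm hidem hr0 (fun i => (hrR i).trans hR) l (Q g)
  have h10 : (r i * r j) ^ 2 ≤ R ^ 4 := by
    have := pow_le_pow_left₀ (mul_nonneg (hr0 i) (hr0 j))
      (mul_le_mul (hrR i) (hrR j) (hr0 j) ((hr0 i).trans (hrR i))) 2
    linarith [this, show (R * R) ^ 2 = R ^ 4 by ring]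
  have h11 := mul_le_mul h10 h9 (sq_nonneg _) (by positivity)
  rw [← hT, ← hP] at h8
  rw [h1, h2]
  linarith

end DampedProjections

/-! ### Functions on a product depending on few coordinates -/

section Juntas

open Function

variable {ι : Type*} [Fintype ι] [DecidableEq ι] {α : ι → Type*}

/-- A function on a product that is invariant under changing any single coordinate outside `s`
only depends on the coordinates in `s`. -/
theorem eq_of_update_invariant {β : Type*} {h : (∀ i, α i) → β} {s : Finset ι}
    (H : ∀ i ∉ s, ∀ x y, h (update x i y) = h x) {a b : ∀ i, α i} (hab : ∀ i ∈ s, a i = b i) :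
    h a = h b := by
  have key : ∀ t : Finset ι, Disjoint t s → h (t.piecewise b a) = h a := by
    intro t
    induction t using Finset.induction_on with
    | empty => simp
    | insert i t hi ih =>
      intro hd
      rw [Finset.disjoint_insert_left] at hd
      rw [Finset.piecewise_insert, H i hd.1, ih hd.2]
  rw [← key (Finset.univ \ s) Finset.sdiff_disjoint]
  congr 1
  ext i
  by_cases hi : i ∈ s <;> simp [Finset.piecewise, hi, hab]

/-- A `0/1`-valued function whose mixed second differences all vanish depends on at most one
coordinate. -/
theorem exists_forall_update_eq [Nonempty ι] {f : (∀ i, α i) → ℝ} (h01 : ∀ x, f x = 0 ∨ f x = 1)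
    (hmix : ∀ i j, i ≠ j → ∀ a (x x' : α i) (y y' : α j),
      f (update (update a i x) j y) - f (update (update a i x') j y)
        = f (update (update a i x) j y') - f (update (update a i x') j y')) :
    ∃ p, ∀ i ≠ p, ∀ x y, f (update x i y) = f x := by
  by_cases hdep : ∃ p a x, f (update a p x) ≠ f a
  · obtain ⟨p, a, x, hpx⟩ := hdep
    refine ⟨p, fun j hj b y => ?_⟩
    by_contra hjy
    -- The difference of `f` along a fixed pair of values of one coordinate is constant.
    have hconst : ∀ i (z z' : α i) b b',
        f (update b i z) - f (update b i z') = f (update b' i z) - f (update b' i z') := by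
      intro i z z' b b'
      refine eq_of_update_invariant (s := ∅) (h := fun b => f (update b i z) - f (update b i z'))
        (fun k _ b w => ?_) (by simp)
      rcases eq_or_ne k i with rfl | hki
      · simp
      · have := hmix i k hki.symm b z z' w (b k)
        simpa [update_comm hki.symm] using this
    have e1 := hconst p x (a p) a (update b j y)
    have e2 := hconst p x (a p) a b
    have e3 := hconst j y (b j) b (update b p x)
    rw [update_comm hj, update_comm hj, update_eq_self] at e1
    rw [update_eq_self] at e2
    rw [update_comm hj.symm x (b j), update_eq_self] at e3
    have hpx' := sub_ne_zero.2 hpx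
    have hjy' := sub_ne_zero.2 hjy
    rw [e2] at e1 hpx'
    rw [e3] at hjy'
    -- Four values `u`, `u + s`, `u + t`, `u + s + t` with `s, t ≠ 0` are not all in `{0, 1}`.
    rcases h01 (update (update b p x) j y) with h1 | h1 <;>
    rcases h01 (update (update b p (a p)) j y) with h2 | h2 <;>
    rcases h01 (update b p x) with h3 | h3 <;>
    rcases h01 (update b p (a p)) with h4 | h4 <;>
    rw [h1, h3] at hjy' <;> rw [h3, h4] at hpx' e1 <;> rw [h1, h2] at e1 <;> norm_num at *
  · push Not at hdep
    exact ⟨Classical.arbitrary ι, fun i _ x y => hdep i x y⟩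

end Juntas

/-! ### Averaging over one coordinate -/

section Averages

open Function

variable {ι : Type*} [DecidableEq ι] {α : ι → Type*} [∀ i, Fintype (α i)]

/-- Averaging over coordinate `i`: the orthogonal projection onto the functions that do not depend
on it. Functions are vectors of `EuclideanSpace` so as to carry the `ℓ²` inner product. -/
noncomputable def coordAvg (i : ι) : Module.End ℝ (EuclideanSpace ℝ (∀ i, α i)) where
  toFun f := WithLp.toLp 2 fun x => (∑ y, f (update x i y)) / Fintype.card (α i)
  map_add' f g := by
    ext x
    simp [Finset.sum_add_distrib, add_div]
  map_smul' a f := by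
    ext x
    simp [← Finset.mul_sum, mul_div_assoc]

theorem coordAvg_apply (i : ι) (f : EuclideanSpace ℝ (∀ i, α i)) (x : ∀ i, α i) :
    coordAvg i f x = (∑ y, f (update x i y)) / Fintype.card (α i) := rfl

theorem coordAvg_update (i : ι) (f : EuclideanSpace ℝ (∀ i, α i)) (x : ∀ i, α i) (y : α i) :
    coordAvg i f (update x i y) = coordAvg i f x := by
  simp [coordAvg_apply]

theorem coordAvg_mul_self [∀ i, Nonempty (α i)] (i : ι) :
    coordAvg (α := α) i * coordAvg i = coordAvg i := by
  refine LinearMap.ext fun f => ?_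
  ext x
  rw [Module.End.mul_apply, coordAvg_apply i (coordAvg i f)]
  simp [coordAvg_update]

theorem commute_coordAvg (i j : ι) : Commute (coordAvg (α := α) i) (coordAvg j) := by
  rcases eq_or_ne i j with rfl | hij
  · exact Commute.refl _
  refine LinearMap.ext fun f => ?_
  ext x
  simp only [Module.End.mul_apply, coordAvg_apply]
  rw [← Finset.sum_div, ← Finset.sum_div, Finset.sum_comm, div_right_comm]
  simp_rw [update_comm hij]

/-- If the part of `f` orthogonal both to the functions independent of coordinate `i` and to those
independent of `j` is zero, then `f` is a sum of two such functions, so its mixed differences in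
these coordinates vanish. -/
theorem mixed_difference_eq_zero {i j : ι} (hij : i ≠ j) {f : EuclideanSpace ℝ (∀ i, α i)}
    (hf : ((1 - coordAvg i) * (1 - coordAvg j) : Module.End ℝ _) f = 0) (a : ∀ i, α i)
    (x x' : α i) (y y' : α j) :
    f (update (update a i x) j y) - f (update (update a i x') j y)
      = f (update (update a i x) j y') - f (update (update a i x') j y') := by
  have h : f = coordAvg i f + (coordAvg j f - coordAvg j (coordAvg i f)) := by
    have h1 : coordAvg i (coordAvg j f) = coordAvg j (coordAvg i f) :=
      LinearMap.congr_fun (commute_coordAvg i j) f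
    rw [← h1]
    have h2 : f - coordAvg j f - (coordAvg i f - coordAvg i (coordAvg j f)) = 0 := by
      simpa using hf
    rw [← sub_eq_zero, ← h2]
    abel
  have hu : ∀ z w, f (update (update a i z) j w) =
      coordAvg i f (update a j w) +
        (coordAvg j f (update a i z) - coordAvg j (coordAvg i f) (update a i z)) := by
    intro z w
    conv_lhs => rw [h]
    simp only [PiLp.add_apply, PiLp.sub_apply, coordAvg_update]
    rw [update_comm hij, coordAvg_update]
  simp only [hu]
  ring

variable [Fintype ι]

theorem sum_sum_update_swap (i : ι) (f g : (∀ i, α i) → ℝ) :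
    ∑ x, ∑ y, f x * g (update x i y) = ∑ x, ∑ y, f (update x i y) * g x := by
  have hinv : Involutive fun p : (∀ i, α i) × α i => (update p.1 i p.2, p.1 i) := by
    rintro ⟨x, y⟩
    simp
  rw [← Fintype.sum_prod_type' (f := fun x y => f x * g (update x i y)),
    ← Fintype.sum_prod_type' (f := fun x y => f (update x i y) * g x)]
  refine Fintype.sum_equiv hinv.toPerm _ _ fun p => ?_
  simp [Involutive.toPerm]

theorem isSymmetric_coordAvg (i : ι) : (coordAvg (α := α) i).IsSymmetric := by
  intro f g
  simp only [PiLp.inner_apply, coordAvg_apply, RCLike.inner_apply, conj_trivial]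
  simp_rw [mul_div_assoc', ← Finset.sum_div, div_mul_eq_mul_div, ← Finset.sum_div]
  congr 1
  simp_rw [Finset.mul_sum, Finset.sum_mul]
  exact sum_sum_update_swap i g f

theorem sum_coordAvg [∀ i, Nonempty (α i)] (i : ι) (f : EuclideanSpace ℝ (∀ i, α i)) :
    ∑ x, coordAvg i f x = ∑ x, f x := by
  simp_rw [coordAvg_apply]
  have := sum_sum_update_swap i (fun _ => 1) f
  simp only [one_mul, Finset.sum_const, Finset.card_univ, nsmul_eq_mul] at this
  rw [← Finset.sum_div, this, ← Finset.mul_sum, mul_div_cancel_left₀]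
  exact_mod_cast Fintype.card_ne_zero

theorem sum_dampedProd [∀ i, Nonempty (α i)] (r : ι → ℝ) (l : List ι)
    (f : EuclideanSpace ℝ (∀ i, α i)) : ∑ x, dampedProd coordAvg r l f x = ∑ x, f x := by
  induction l with
  | nil => simp [dampedProd]
  | cons i l ih =>
    rw [← ih, dampedProd_cons_apply]
    simp [Finset.sum_add_distrib, ← Finset.mul_sum, sum_coordAvg]

/-- The product of the averages over all coordinates is the mean. -/
theorem projProd_apply [∀ i, Nonempty (α i)] {l : List ι} (hl : ∀ i, i ∈ l)
    (g : EuclideanSpace ℝ (∀ i, α i)) (x : ∀ i, α i) :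
    (l.map coordAvg).prod g x = (∑ y, g y) / Fintype.card (∀ i, α i) := by
  have hinv : ∀ (l : List ι) i, i ∈ l → ∀ (x : ∀ i, α i) y,
      (l.map coordAvg).prod g (update x i y) = (l.map coordAvg).prod g x := by
    intro l
    induction l with
    | nil => simp
    | cons j l ih =>
      intro i hi x y
      rw [List.map_cons, List.prod_cons, Module.End.mul_apply]
      rcases eq_or_ne i j with rfl | hij
      · exact coordAvg_update _ _ _ _
      · have hi' : i ∈ l := (List.mem_cons.1 hi).resolve_left hij
        simp_rw [coordAvg_apply, update_comm hij, ih i hi']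
  have hsum : ∀ l : List ι, ∑ x, (l.map coordAvg).prod g x = ∑ x, g x := by
    intro l
    induction l with
    | nil => simp
    | cons j l ih => rw [← ih, List.map_cons, List.prod_cons, Module.End.mul_apply, sum_coordAvg]
  have hconst : ∀ y, (l.map coordAvg).prod g y = (l.map coordAvg).prod g x := fun y =>
    eq_of_update_invariant (s := ∅) (h := fun y => (l.map coordAvg).prod g y)
      (fun i _ x y => hinv l i (hl i) x y) (by simp)
  have h := hsum l
  simp_rw [hconst] at h
  rw [← h, Finset.sum_const, Finset.card_univ, nsmul_eq_mul, mul_div_cancel_left₀]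
  exact_mod_cast Fintype.card_ne_zero

/-- With damping `1 / (|α i| - 1)`, the `i`-th factor is the normalized sum over the values
different from the present one, so the damped product is the walk on the graph of pairs differing in
exactly the listed coordinates. -/
theorem exists_ne_of_dampedProd_ne_zero (hcard : ∀ i, 2 ≤ Fintype.card (α i)) {l : List ι}
    (hl : l.Nodup) (g : EuclideanSpace ℝ (∀ i, α i)) {x : ∀ i, α i}
    (hx : dampedProd coordAvg (fun i => 1 / ((Fintype.card (α i) : ℝ) - 1)) l g x ≠ 0) :
    ∃ y, g y ≠ 0 ∧ ∀ i ∈ l, x i ≠ y i := by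
  classical
  suffices ∃ y, g y ≠ 0 ∧ (∀ i ∈ l, x i ≠ y i) ∧ ∀ i ∉ l, x i = y i by
    obtain ⟨y, h1, h2, -⟩ := this
    exact ⟨y, h1, h2⟩
  induction l generalizing x with
  | nil => exact ⟨x, by simpa [dampedProd] using hx, by simp, by simp⟩
  | cons i l ih =>
    obtain ⟨hil, hl⟩ := List.nodup_cons.1 hl
    set h := dampedProd coordAvg (fun i => 1 / ((Fintype.card (α i) : ℝ) - 1)) l g with hh
    have hc : (2 : ℝ) ≤ Fintype.card (α i) := by exact_mod_cast hcard i
    have hc1 : (Fintype.card (α i) : ℝ) - 1 ≠ 0 := by linarith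
    have hc0 : (Fintype.card (α i) : ℝ) ≠ 0 := by linarith
    have h1 : dampedProd coordAvg (fun i => 1 / ((Fintype.card (α i) : ℝ) - 1)) (i :: l) g x
        = (∑ y ∈ Finset.univ.erase (x i), h (update x i y)) / ((Fintype.card (α i) : ℝ) - 1) := by
      rw [dampedProd_cons_apply, ← hh]
      simp only [PiLp.add_apply, PiLp.smul_apply, PiLp.sub_apply, smul_eq_mul, coordAvg_apply]
      rw [Finset.sum_erase_eq_sub (Finset.mem_univ _), update_eq_self]
      field_simp
      ring
    rw [h1] at hx
    obtain ⟨y, hy, hxy⟩ := Finset.exists_ne_zero_of_sum_ne_zero (left_ne_zero_of_mul hx)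
    obtain ⟨z, hz, hz1, hz2⟩ := ih hl hxy
    have hzi : z i = y := by simpa using (hz2 i hil).symm
    refine ⟨z, hz, fun j hj => ?_, fun j hj => ?_⟩
    · rcases eq_or_ne j i with rfl | hji
      · rw [hzi]
        exact (Finset.ne_of_mem_erase hy).symm
      · simpa [hji] using hz1 j ((List.mem_cons.1 hj).resolve_left hji)
    · rw [List.mem_cons, not_or] at hj
      simpa [hj.1] using hz2 j hj.2

end Averages

/-! ### Cross-intersecting families in a product of finite types -/

/-- The real inequality behind the ratio bound, for densities `a` and `b`; `q` measures the slack in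
the spectral estimate. -/
theorem mul_le_and_slack_eq_zero {a b q K : ℝ} (hK : 2 ≤ K) (ha0 : 0 ≤ a) (ha1 : a ≤ 1)
    (hb0 : 0 ≤ b) (hb1 : b ≤ 1) (hq : 0 ≤ q)
    (h : (a * b) ^ 2 ≤ a * (1 - a) * ((1 / (K - 1)) ^ 2 * (b * (1 - b)) - q)) :
    a * b ≤ (1 / K) ^ 2 ∧ (a * b = (1 / K) ^ 2 → q = 0) := by
  have hK1 : 0 < K - 1 := by linarith
  set R := 1 / (K - 1) with hR
  have hRK : R * (K - 1) = 1 := by rw [hR]; field_simp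
  have hR0 : 0 < R := by positivity
  set s := √(a * b) with hs
  have hs0 : 0 ≤ s := Real.sqrt_nonneg _
  have hs2 : s ^ 2 = a * b := Real.sq_sqrt (mul_nonneg ha0 hb0)
  have hs1 : s ≤ 1 :=
    Real.sqrt_le_one.2 (mul_le_one₀ ha1 hb0 hb1)
  -- The arithmetic-geometric mean inequality, squared to avoid the root.
  have hab : 2 * s ≤ a + b := by
    refine abs_le_of_sq_le_sq' ?_ (by linarith) |>.2
    nlinarith [sq_nonneg (a - b)]
  have h1 : (1 - a) * (1 - b) ≤ (1 - s) ^ 2 := by nlinarith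
  have h2 : s ^ 2 * s ^ 2 + a * (1 - a) * q ≤ s ^ 2 * (R * (1 - s)) ^ 2 := by
    have h3 := mul_le_mul_of_nonneg_left h1 (mul_nonneg (sq_nonneg R) (sq_nonneg s))
    rw [← hs2] at h
    have h4 : a * (1 - a) * (R ^ 2 * (b * (1 - b)) - q)
      = R ^ 2 * s ^ 2 * ((1 - a) * (1 - b)) - a * (1 - a) * q := by rw [hs2]; ring
    nlinarith
  have h5 : 0 ≤ a * (1 - a) * q := mul_nonneg (mul_nonneg ha0 (by linarith)) hq
  have hsK : s ≤ 1 / K := by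
    rcases hs0.eq_or_lt with h0 | h0
    · rw [← h0]; positivity
    have h6 : s ^ 2 ≤ (R * (1 - s)) ^ 2 :=
      le_of_mul_le_mul_left (by linarith) (by positivity : 0 < s ^ 2)
    have h7 : s ≤ R * (1 - s) :=
      abs_le_of_sq_le_sq' h6 (mul_nonneg hR0.le (by linarith)) |>.2
    rw [le_div_iff₀ (by linarith)]
    have := mul_le_mul_of_nonneg_right h7 hK1.le
    rw [mul_right_comm, hRK] at this
    linarith
  refine ⟨hs2 ▸ pow_le_pow_left₀ hs0 hsK 2, fun heq => ?_⟩
  have hsK' : s = 1 / K := by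
    rw [hs, heq, Real.sqrt_sq (by positivity)]
  have hspos : 0 < s := by rw [hsK']; positivity
  have hsR : R * (1 - s) = s := by
    have : 1 - s = (K - 1) * s := by rw [hsK']; field_simp
    rw [this, ← mul_assoc, hRK, one_mul]
  rw [hsR] at h2
  have ha : 0 < a := by
    refine ha0.lt_of_ne fun h => ?_
    rw [← h, zero_mul] at hs2
    exact (pow_pos hspos 2).ne' hs2
  have ha' : a < 1 := by
    refine ha1.lt_of_ne fun h' => ?_
    rw [← hs2, h', sub_self, mul_zero, zero_mul] at h
    have := pow_pos (pow_pos hspos 2) 2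
    linarith
  have h8 : 0 < a * (1 - a) := mul_pos ha (by linarith)
  nlinarith

section Families

open Function

variable {ι : Type*} [Fintype ι] [DecidableEq ι] {α : ι → Type*} [∀ i, Fintype (α i)]

open Classical in
/-- The indicator function of a finite set, as a vector of the `ℓ²` space. -/
noncomputable def indVec {X : Type*} (A : Finset X) : EuclideanSpace ℝ X :=
  WithLp.toLp 2 fun x => if x ∈ A then 1 else 0

theorem indVec_apply_ne_zero {X : Type*} {A : Finset X} {x : X} : indVec A x ≠ 0 ↔ x ∈ A := by
  simp [indVec]

theorem sum_indVec {X : Type*} [Fintype X] (A : Finset X) : ∑ x, indVec A x = A.card := by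
  simp [indVec]

theorem inner_indVec {X : Type*} [Fintype X] (A : Finset X) (v : EuclideanSpace ℝ X) :
    inner ℝ (indVec A) v = ∑ x ∈ A, v x := by
  simp [indVec, PiLp.inner_apply]

theorem norm_sq_indVec_sub_mean {X : Type*} [Fintype X] [Nonempty X] (A : Finset X)
    {v : EuclideanSpace ℝ X} (hv : ∀ x, v x = A.card / Fintype.card X) :
    ‖indVec A - v‖ ^ 2 = A.card - (A.card : ℝ) ^ 2 / Fintype.card X := by
  have hN : (Fintype.card X : ℝ) ≠ 0 := by simp
  have hvv : inner ℝ v v = (A.card : ℝ) ^ 2 / Fintype.card X := by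
    simp only [PiLp.inner_apply, hv]
    simp
    field_simp
  have hAv : inner ℝ (indVec A) v = (A.card : ℝ) ^ 2 / Fintype.card X := by
    simp [inner_indVec, hv]
    field_simp
  have hAA : inner ℝ (indVec A) (indVec A) = (A.card : ℝ) := by
    rw [inner_indVec, Finset.sum_congr rfl (g := fun _ => (1 : ℝ))] <;> simp [indVec]
  rw [norm_sub_sq_real, ← real_inner_self_eq_norm_sq, ← real_inner_self_eq_norm_sq, hvv, hAv, hAA]
  ring

/-- The ratio bound for a cross-intersecting pair, from a spectral estimate for the indicator of `B`
with an extra term `q`, which must vanish if the bound is attained. -/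
theorem card_mul_card_le_of_gap [∀ i, Nonempty (α i)] {k : ℕ} (hk : 2 ≤ k)
    (hcard : ∀ i, k ≤ Fintype.card (α i))
    {A B : Finset (∀ i, α i)} (hAB : ∀ a ∈ A, ∀ b ∈ B, ∃ i, a i = b i)
    {l : List ι} (hnd : l.Nodup) (hl : ∀ i, i ∈ l) {q : ℝ} (hq : 0 ≤ q)
    (hgap : ‖dampedProd (coordAvg (α := α)) (fun i => 1 / ((Fintype.card (α i) : ℝ) - 1)) l
          (indVec B) - (l.map coordAvg).prod (indVec B)‖ ^ 2 ≤
      (1 / ((k : ℝ) - 1)) ^ 2 * ‖indVec B - (l.map coordAvg).prod (indVec B)‖ ^ 2 - q) :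
    (A.card : ℝ) * B.card ≤ (Fintype.card (∀ i, α i) / (k : ℝ)) ^ 2 ∧
      ((A.card : ℝ) * B.card = (Fintype.card (∀ i, α i) / (k : ℝ)) ^ 2 → q = 0) := by
  set T := dampedProd (coordAvg (α := α)) (fun i => 1 / ((Fintype.card (α i) : ℝ) - 1)) l
  set P := (l.map (coordAvg (α := α))).prod
  set N : ℝ := (Fintype.card (∀ i, α i) : ℝ) with hNdef
  have hN : 0 < N := by rw [hNdef]; exact_mod_cast Fintype.card_pos
  have hP : ∀ (C : Finset (∀ i, α i)) x, P (indVec C) x = C.card / N := fun C x => by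
    rw [projProd_apply hl, sum_indVec]
  have hT : inner ℝ (indVec A) (T (indVec B)) = 0 := by
    rw [inner_indVec]
    refine Finset.sum_eq_zero fun a ha => ?_
    by_contra h
    obtain ⟨b, hb, hab⟩ :=
      exists_ne_of_dampedProd_ne_zero (fun i => hk.trans (hcard i)) hnd (indVec B) h
    obtain ⟨i, hi⟩ := hAB a ha b (indVec_apply_ne_zero.1 hb)
    exact hab i (hl i) hi
  have hmean : ∀ v, inner ℝ (P (indVec A)) v = A.card / N * ∑ x, v x := fun v => by
    simp [PiLp.inner_apply, hP, ← Finset.sum_mul, mul_comm]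
  have hTP : inner ℝ (indVec A - P (indVec A)) (T (indVec B) - P (indVec B))
      = - (A.card * B.card / N) := by
    have hsum : ∑ x, (T (indVec B) - P (indVec B)) x = 0 := by
      have := sum_dampedProd (fun i => 1 / ((Fintype.card (α i) : ℝ) - 1)) l (indVec B)
      simp only [PiLp.sub_apply, Finset.sum_sub_distrib, hP]
      rw [this, sum_indVec, Finset.sum_const, Finset.card_univ, nsmul_eq_mul, ← hNdef,
        mul_div_cancel₀ _ hN.ne', sub_self]
    rw [inner_sub_left, hmean, hsum, inner_sub_right, hT, inner_indVec]
    simp only [hP, Finset.sum_const, nsmul_eq_mul]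
    ring
  -- Cauchy-Schwarz after removing the means.
  have hCS := real_inner_mul_inner_self_le (indVec A - P (indVec A)) (T (indVec B) - P (indVec B))
  rw [hTP, real_inner_self_eq_norm_sq, real_inner_self_eq_norm_sq,
    norm_sq_indVec_sub_mean A (hP A)] at hCS
  rw [norm_sq_indVec_sub_mean B (hP B)] at hgap
  have hle : ∀ C : Finset (∀ i, α i), (C.card : ℝ) / N ≤ 1 := fun C => by
    rw [div_le_one hN, hNdef]
    exact_mod_cast Finset.card_le_univ C
  have key := mul_le_and_slack_eq_zero (a := A.card / N) (b := B.card / N) (q := q / N) (K := k)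
    (by exact_mod_cast hk) (by positivity) (hle A) (by positivity) (hle B) (by positivity) (by
      have hA : 0 ≤ (A.card : ℝ) - (A.card : ℝ) ^ 2 / N := by
        rw [← norm_sq_indVec_sub_mean A (hP A)]; positivity
      have := hCS.trans (mul_le_mul_of_nonneg_left hgap hA)
      have h2 := mul_le_mul_of_nonneg_left this (by positivity : 0 ≤ (1 / N) ^ 2)
      calc _ = (1 / N) ^ 2 * (-(↑A.card * ↑B.card / N) * -(↑A.card * ↑B.card / N)) := by
            field_simp
        _ ≤ _ := h2
        _ = _ := by rw [← hNdef]; field_simp)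
  have h1 : (A.card : ℝ) * B.card = N ^ 2 * (A.card / N * (B.card / N)) := by field_simp
  have h2 : (N / (k : ℝ)) ^ 2 = N ^ 2 * (1 / (k : ℝ)) ^ 2 := by ring
  rw [h1, h2]
  refine ⟨mul_le_mul_of_nonneg_left key.1 (by positivity), fun h => ?_⟩
  have := key.2 (mul_left_cancel₀ (by positivity) h)
  simpa [hN.ne'] using this

theorem damping_bounds {k c : ℕ} (hk : 2 ≤ k) (hkc : k ≤ c) :
    0 ≤ 1 / ((c : ℝ) - 1) ∧ 1 / ((c : ℝ) - 1) ≤ 1 / ((k : ℝ) - 1) ∧ 1 / ((k : ℝ) - 1) ≤ 1 := by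
  have h1 : (2 : ℝ) ≤ k := by exact_mod_cast hk
  have h2 : (k : ℝ) ≤ c := by exact_mod_cast hkc
  refine ⟨one_div_nonneg.2 (by linarith), ?_, ?_⟩
  · exact one_div_le_one_div_of_le (by linarith) (by linarith)
  · rw [div_le_one (by linarith)]
    linarith

theorem card_mul_card_le {k : ℕ} (hk : 2 ≤ k) (hcard : ∀ i, k ≤ Fintype.card (α i))
    {A B : Finset (∀ i, α i)} (hAB : ∀ a ∈ A, ∀ b ∈ B, ∃ i, a i = b i) :
    (A.card : ℝ) * B.card ≤ (Fintype.card (∀ i, α i) / (k : ℝ)) ^ 2 := by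
  have : ∀ i, Nonempty (α i) := fun i => Fintype.card_pos_iff.1 (by have := hcard i; omega)
  refine (card_mul_card_le_of_gap hk hcard hAB (Finset.nodup_toList Finset.univ) (by simp) le_rfl
    ?_).1
  rw [sub_zero]
  exact norm_dampedProd_sub_le isSymmetric_coordAvg coordAvg_mul_self commute_coordAvg
    (fun i => (damping_bounds hk (hcard i)).1) (fun i => (damping_bounds hk (hcard i)).2.1)
    (damping_bounds hk le_rfl).2.2 _ _

/-- In the extremal case the indicator of `B` has no component depending jointly on two coordinates
`i` and `j`. This needs
`3 ≤ k`: for `k = 2` the damping factor is `1` and damping twice gains nothing. -/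
theorem mixed_part_eq_zero_of_card_mul_card_eq {k : ℕ} (hk : 3 ≤ k)
    (hcard : ∀ i, k ≤ Fintype.card (α i)) {A B : Finset (∀ i, α i)}
    (hAB : ∀ a ∈ A, ∀ b ∈ B, ∃ i, a i = b i)
    (heq : (A.card : ℝ) * B.card = (Fintype.card (∀ i, α i) / (k : ℝ)) ^ 2) {i j : ι}
    (hij : i ≠ j) :
    ((1 - coordAvg i) * (1 - coordAvg j) : Module.End ℝ _) (indVec B) = 0 := by
  have : ∀ i, Nonempty (α i) := fun i => Fintype.card_pos_iff.1 (by have := hcard i; omega)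
  have hk2 : 2 ≤ k := by omega
  have hR : 0 < (1 / ((k : ℝ) - 1)) ^ 2 - (1 / ((k : ℝ) - 1)) ^ 4 := by
    have h3 : (3 : ℝ) ≤ k := by exact_mod_cast hk
    refine sub_pos.2 (pow_lt_pow_right_of_lt_one₀ (one_div_pos.2 (by linarith)) ?_ (by norm_num))
    rw [div_lt_one (by linarith)]
    linarith
  have hq := (card_mul_card_le_of_gap hk2 hcard hAB
    (l := i :: j :: ((Finset.univ.erase i).erase j).toList)
    (by simp [hij, Finset.nodup_toList]) (fun x => by simp; tauto) (mul_nonneg hR.le (sq_nonneg _))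
    (norm_dampedProd_sub_le_of_pair isSymmetric_coordAvg coordAvg_mul_self commute_coordAvg
      (fun i => (damping_bounds hk2 (hcard i)).1) (fun i => (damping_bounds hk2 (hcard i)).2.1)
      (damping_bounds hk2 le_rfl).2.2 i j _ (indVec B))).2 heq
  exact norm_eq_zero.1 (pow_eq_zero_iff two_ne_zero |>.1 ((mul_eq_zero.1 hq).resolve_left hR.ne'))

theorem exists_mem_iff_of_card_mul_card_eq [Nonempty ι] {k : ℕ} (hk : 3 ≤ k)
    (hcard : ∀ i, k ≤ Fintype.card (α i)) {A B : Finset (∀ i, α i)}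
    (hAB : ∀ a ∈ A, ∀ b ∈ B, ∃ i, a i = b i)
    (heq : (A.card : ℝ) * B.card = (Fintype.card (∀ i, α i) / (k : ℝ)) ^ 2) :
    ∃ p, ∀ x y : ∀ i, α i, x p = y p → (x ∈ B ↔ y ∈ B) := by
  obtain ⟨p, hp⟩ := exists_forall_update_eq (f := fun x => indVec B x)
    (fun x => by by_cases h : x ∈ B <;> simp [indVec, h])
    (fun i j hij a x x' y y' => mixed_difference_eq_zero hij
      (mixed_part_eq_zero_of_card_mul_card_eq hk hcard hAB heq hij) a x x' y y')
  refine ⟨p, fun x y hxy => ?_⟩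
  have : indVec B x = indVec B y :=
    eq_of_update_invariant (s := {p}) (h := fun x => indVec B x)
      (fun i hi => hp i (by simpa using hi)) (by simpa using hxy)
  rw [← indVec_apply_ne_zero, this, indVec_apply_ne_zero]

theorem eq_star_of_card_mul_card_eq [Nonempty ι] {k : ℕ} (hk : 3 ≤ k)
    (hcard : ∀ i, k ≤ Fintype.card (α i)) {A B : Finset (∀ i, α i)}
    (hAB : ∀ a ∈ A, ∀ b ∈ B, ∃ i, a i = b i)
    (heq : (A.card : ℝ) * B.card = (Fintype.card (∀ i, α i) / (k : ℝ)) ^ 2) :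
    ∃ p q, (∀ x, x ∈ A ↔ x p = q) ∧ ∀ x, x ∈ B ↔ x p = q := by
  have hne : ∀ i, Nonempty (α i) := fun i => Fintype.card_pos_iff.1 (by have := hcard i; omega)
  have hnt : ∀ i, Nontrivial (α i) := fun i =>
    Fintype.one_lt_card_iff_nontrivial.1 (by have := hcard i; omega)
  obtain ⟨p', hB⟩ := exists_mem_iff_of_card_mul_card_eq hk hcard hAB heq
  obtain ⟨p, hA⟩ := exists_mem_iff_of_card_mul_card_eq hk hcard (A := B) (B := A)
    (fun b hb a ha => (hAB a ha b hb).imp fun _ => Eq.symm) (by rw [mul_comm, heq])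
  have hpos : 0 < (A.card : ℝ) * B.card := by
    have : 0 < Fintype.card (∀ i, α i) := Fintype.card_pos
    rw [heq]
    positivity
  obtain ⟨a, ha⟩ : A.Nonempty := by
    rw [← Finset.card_pos]
    exact_mod_cast pos_of_mul_pos_left hpos (by positivity)
  obtain ⟨b, hb⟩ : B.Nonempty := by
    rw [← Finset.card_pos]
    exact_mod_cast pos_of_mul_pos_right hpos (by positivity)
  choose d hd using fun (i : ι) (x : α i) => exists_ne x
  obtain rfl : p' = p := by
    by_contra hpp
    -- Move `b` off `a` at `p`, and then `a` off `b` everywhere else.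
    set b' := update b p (d p (a p)) with hb'
    have hb'B : b' ∈ B := (hB b' b (by simp [hb', hpp])).2 hb
    set a' := update (fun i => d i (b' i)) p (a p) with ha'
    have ha'A : a' ∈ A := (hA a' a (by simp [ha'])).2 ha
    obtain ⟨i, hi⟩ := hAB a' ha'A b' hb'B
    rcases eq_or_ne i p with rfl | hip
    · simp only [ha', hb', update_self] at hi
      exact hd _ _ hi.symm
    · simp only [ha', update_of_ne hip] at hi
      exact hd _ _ hi
  have hmeet : ∀ a ∈ A, ∀ b ∈ B, a p' = b p' := by
    intro a ha b hb
    by_contra hne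
    -- Move `a` off `b` at every coordinate but `p'`.
    have ha' : update (fun i => d i (b i)) p' (a p') ∈ A := (hA _ a (by simp)).2 ha
    obtain ⟨i, hi⟩ := hAB _ ha' b hb
    rcases eq_or_ne i p' with rfl | hip
    · exact hne (by simpa using hi)
    · simp only [update_of_ne hip] at hi
      exact hd _ _ hi
  refine ⟨p', a p', fun x => ⟨fun hx => ?_, fun hx => (hA x a hx).2 ha⟩,
    fun x => ⟨fun hx => (hmeet a ha x hx).symm, fun hx => ?_⟩⟩
  · rw [hmeet x hx b hb, hmeet a ha b hb]
  · exact (hB x b (hx.trans (hmeet a ha b hb))).2 hb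

end Families

/-! ### Integer sequences -/

section Sequences

variable {n : ℕ} {c : Fin n → ℕ}

theorem card_seqSet (c : Fin n → ℕ) : (seqSet c).card = ∏ i, c i := by
  simp [seqSet, Fintype.card_piFinset]

theorem card_seqStar_mul {p : Fin n} {q : ℕ} (hq : q ∈ Finset.Icc 1 (c p)) :
    (seqStar c p q).card * c p = (seqSet c).card := by
  have h : seqStar c p q
      = Fintype.piFinset (Function.update (fun i => Finset.Icc 1 (c i)) p {q}) := by
    ext a
    simp only [seqStar, seqSet, Finset.mem_filter, Fintype.mem_piFinset]
    grind
  rw [h, seqSet, Fintype.card_piFinset, Fintype.card_piFinset,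
    ← Finset.prod_erase_mul _ _ (Finset.mem_univ p),
    ← Finset.prod_erase_mul _ (fun i => (Finset.Icc 1 (c i)).card) (Finset.mem_univ p)]
  simp only [Function.update_self, Finset.card_singleton, mul_one, Nat.card_Icc,
    Nat.add_sub_cancel]
  congr 1
  refine Finset.prod_congr rfl fun i hi => ?_
  simp [Finset.ne_of_mem_erase hi]

theorem card_seqStar (hc : ∀ i, 1 ≤ c i) {p : Fin n} {q : ℕ} (hq : q ∈ Finset.Icc 1 (c p)) :
    ((seqStar c p q).card : ℝ) = (seqSet c).card / c p := by
  have : (c p : ℝ) ≠ 0 := by have := hc p; positivity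
  rw [eq_div_iff this]
  exact_mod_cast card_seqStar_mul hq

theorem crossIntersecting_seqStar {p : Fin n} {q : ℕ} (hq : q ≠ 0) :
    CrossIntersecting (seqStar c p q) (seqStar c p q) := by
  intro a ha b hb
  have ha' := (Finset.mem_filter.1 ha).2
  have hb' := (Finset.mem_filter.1 hb).2
  exact ⟨p, ha'.trans hb'.symm, ha' ▸ hq⟩

/-- A family of sequences as a family in the product of the types `Finset.Icc 1 (c i)`; members
outside `seqSet c` are dropped. -/
def liftFamily (c : Fin n → ℕ) (A : Finset (Fin n → ℕ)) :
    Finset (∀ i, Finset.Icc 1 (c i)) :=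
  Finset.univ.filter fun x => (fun i => (x i : ℕ)) ∈ A

theorem mem_liftFamily {A : Finset (Fin n → ℕ)} {x : ∀ i, Finset.Icc 1 (c i)} :
    x ∈ liftFamily c A ↔ (fun i => (x i : ℕ)) ∈ A := by
  simp [liftFamily]

theorem card_liftFamily {A : Finset (Fin n → ℕ)} (hA : A ⊆ seqSet c) :
    (liftFamily c A).card = A.card := by
  refine Finset.card_bij (fun x _ i => (x i : ℕ)) (fun x hx => mem_liftFamily.1 hx)
    (fun x _ y _ hxy => funext fun i => Subtype.ext (congrFun hxy i)) fun a ha => ?_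
  exact ⟨fun i => ⟨a i, Fintype.mem_piFinset.1 (hA ha) i⟩, mem_liftFamily.2 ha, rfl⟩

theorem eq_seqStar_of_liftFamily {A : Finset (Fin n → ℕ)} (hA : A ⊆ seqSet c) {p : Fin n}
    {q : Finset.Icc 1 (c p)} (h : ∀ x, x ∈ liftFamily c A ↔ x p = q) : A = seqStar c p q := by
  ext a
  rw [seqStar, Finset.mem_filter]
  by_cases ha : a ∈ seqSet c
  · have := h fun i => ⟨a i, Fintype.mem_piFinset.1 ha i⟩
    rw [mem_liftFamily, Subtype.ext_iff] at this
    simpa [ha] using this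
  · exact ⟨fun h => absurd (hA h) ha, fun h => absurd h.1 ha⟩

theorem CrossIntersecting.liftFamily {A B : Finset (Fin n → ℕ)} (h : CrossIntersecting A B) :
    ∀ x ∈ liftFamily c A, ∀ y ∈ liftFamily c B, ∃ i, x i = y i := by
  intro x hx y hy
  obtain ⟨i, hi, -⟩ := h _ (mem_liftFamily.1 hx) _ (mem_liftFamily.1 hy)
  exact ⟨i, Subtype.ext hi⟩

theorem card_mul_card_le_seqSet [NeZero n] (hc : IsIPSeq c) {A B : Finset (Fin n → ℕ)}
    (hA : A ⊆ seqSet c) (hB : B ⊆ seqSet c) (h : CrossIntersecting A B) :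
    (A.card : ℝ) * B.card ≤ ((seqSet c).card / (c 0 : ℝ)) ^ 2 := by
  -- For `c 0 = 1` the damping factor would be `1 / 0`, but the bound is then the trivial one.
  rcases (hc.2 0).eq_or_lt with h1 | h1
  · rw [← h1, Nat.cast_one, div_one, sq]
    exact_mod_cast Nat.mul_le_mul (Finset.card_le_card hA) (Finset.card_le_card hB)
  · have := card_mul_card_le h1 (fun i => by simpa using hc.1 (Fin.zero_le i))
      (CrossIntersecting.liftFamily (c := c) h)
    rw [card_liftFamily hA, card_liftFamily hB] at this
    simpa [card_seqSet] using this

theorem exists_eq_seqStar [NeZero n] (hc : IsIPSeq c) (h2 : c 0 ≠ 2) {A B : Finset (Fin n → ℕ)}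
    (hA : A ⊆ seqSet c) (hB : B ⊆ seqSet c) (h : CrossIntersecting A B)
    (heq : (A.card : ℝ) * B.card = ((seqSet c).card / (c 0 : ℝ)) ^ 2) :
    ∃ p : Fin n, c p = c 0 ∧ ∃ q ∈ Finset.Icc 1 (c p), A = seqStar c p q ∧ B = seqStar c p q := by
  have hS : 0 < (seqSet c).card := by
    rw [card_seqSet]
    exact Finset.prod_pos fun i _ => hc.2 i
  have hc0 : 0 < c 0 := hc.2 0
  rcases (hc.2 0).eq_or_lt with h1 | h1
  -- For `c 0 = 1` every sequence starts with `1`, so the whole of `seqSet c` is a star.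
  · have hstar : seqSet c = seqStar c 0 1 := by
      refine (Finset.filter_true_of_mem fun a ha => ?_).symm
      have := Finset.mem_Icc.1 (Fintype.mem_piFinset.1 ha 0)
      omega
    rw [← h1, Nat.cast_one, div_one, sq] at heq
    have heq' : A.card * B.card = (seqSet c).card * (seqSet c).card := by exact_mod_cast heq
    have hA' := Finset.card_le_card hA
    have hB' := Finset.card_le_card hB
    refine ⟨0, rfl, 1, by simp [← h1], ?_, ?_⟩ <;> rw [← hstar]
    · exact Finset.eq_of_subset_of_card_le hA (by nlinarith)
    · exact Finset.eq_of_subset_of_card_le hB (by nlinarith)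
  · obtain ⟨p, q, hpA, hpB⟩ := eq_star_of_card_mul_card_eq (k := c 0) (by omega)
      (fun i => by simpa using hc.1 (Fin.zero_le i)) (CrossIntersecting.liftFamily (c := c) h)
      (by rw [card_liftFamily hA, card_liftFamily hB, heq]; simp [card_seqSet])
    have hAs := eq_seqStar_of_liftFamily hA hpA
    have hBs := eq_seqStar_of_liftFamily hB hpB
    refine ⟨p, ?_, q, q.2, hAs, hBs⟩
    have hcp : 0 < c p := hc.2 p
    rw [hAs, hBs, card_seqStar hc.2 q.2, ← sq,
      pow_left_inj₀ (by positivity) (by positivity) two_ne_zero,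
      div_eq_div_iff (by positivity) (by positivity)] at heq
    exact_mod_cast (mul_left_cancel₀ (by positivity) heq).symm

end Sequences

theorem theorem1 (n : ℕ) [NeZero n] (c : Fin n → ℕ) (hc : IsIPSeq c) :
    (((seqSet c).card : ℝ) / (c 0 : ℝ)) ^ 2 = ((1 / (c 0 : ℝ)) * ∏ i, (c i : ℝ)) ^ 2 ∧
    (∀ A B : Finset (Fin n → ℕ), A ⊆ seqSet c → B ⊆ seqSet c → CrossIntersecting A B →
      (A.card : ℝ) * (B.card : ℝ) ≤ (((seqSet c).card : ℝ) / (c 0 : ℝ)) ^ 2 ∧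
      (c 0 ≠ 2 →
        ((A.card : ℝ) * (B.card : ℝ) = (((seqSet c).card : ℝ) / (c 0 : ℝ)) ^ 2 ↔
          ∃ p : Fin n, c p = c 0 ∧ ∃ q ∈ Finset.Icc 1 (c p),
            A = seqStar c p q ∧ B = seqStar c p q))) ∧
    (CrossIntersecting (seqStar c 0 1) (seqStar c 0 1) ∧
      ((seqStar c 0 1).card : ℝ) * ((seqStar c 0 1).card : ℝ)
        = (((seqSet c).card : ℝ) / (c 0 : ℝ)) ^ 2) := by
  have hstar : ∀ {p : Fin n} {q : ℕ}, c p = c 0 → q ∈ Finset.Icc 1 (c p) →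
      ((seqStar c p q).card : ℝ) * (seqStar c p q).card
        = (((seqSet c).card : ℝ) / (c 0 : ℝ)) ^ 2 := by
    intro p q hp hq
    rw [card_seqStar hc.2 hq, hp, sq]
  refine ⟨?_, fun A B hA hB hAB => ⟨card_mul_card_le_seqSet hc hA hB hAB,
    fun h2 => ⟨exists_eq_seqStar hc h2 hA hB hAB, ?_⟩⟩,
    crossIntersecting_seqStar one_ne_zero, hstar rfl (by simpa using hc.2 0)⟩
  · rw [card_seqSet, Nat.cast_prod, div_eq_inv_mul, one_div]
  · rintro ⟨p, hp, q, hq, rfl, rfl⟩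
    exact hstar hp hq
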